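/- Let $D$ be the unit square in $\mathbb{R}^2$, let $0<a<b$ and $\beta\ge 0$, and for $y\in\mathbb{R}$ put $\tilde y=a\exp\!\big(\tfrac{(y+1)\log(b/a)}{2}\big)$. Let $Y$ be uniformly distributed on $[-1,1]$ and let $\tilde Y$ be the value of $\tilde y$ at $y=Y$. For $u\in L^2(D)$ and $y\in\mathbb{R}$ let $z(u,y)\in H^1_0(D)$ be the weak solution of $$-\operatorname{div}(\tilde y\,\nabla z)=u \ \text{ in } D,\qquad z=0\ \text{ on }\partial D .$$ Let $z_d\in H^1_0(D)$, $z_d\neq 0$, be an eigenfunction of the Dirichlet Laplacian, and let $\lambda$ be the corresponding eigenvalue of the inverse Laplacian $\Delta^{-1}$, that is, $\Delta^{-1}z_d=\lambda z_d$; equivalently, $\Delta z_d=\mu z_d$ weakly, with $\lambda=\mu^{-1}$ (here necessarily $\mu<0$). Define $$g(u,y)=\tfrac12\|z(u,y)-z_d\|_{L^2(D)}^2+\tfrac{\beta}{2}\|u\|_{L^2(D)}^2,\qquad J(u)=\mathbb{E}[g(u,Y)].$$ Then $z(u,y)$ exists and is unique for all $u\in L^2(D)$ and $y\in\mathbb{R}$,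 the expectations $J(u)$, $\mathbb{E}[\tilde Y^{-1}]$ and $\mathbb{E}[\tilde Y^{-2}]>0$ are finite, and $J$ has exactly one minimizer over $L^2(D)$, namely $$u^\ast=\Big[-\alpha\lambda\,(\lambda^2+\tilde\beta)^{-1}\Big]z_d,\qquad \alpha=\frac{\mathbb{E}[\tilde Y^{-1}]}{\mathbb{E}[\tilde Y^{-2}]},\qquad \tilde\beta=\frac{\beta}{\mathbb{E}[\tilde Y^{-2}]}.$$ Moreover, $u\mapsto g(u,y)$ is Fréchet differentiable on $L^2(D)$ for every $y$, and for every $u\in L^2(D)$ the map $y\mapsto\nabla g(u,y)\in L^2(D)$ ($\nabla$ being the gradient in $u$) is real-analytic in a neighbourhood of every point of $[-1,1]$. -/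

import Mathlib

open MeasureTheory ProbabilityTheory Set
open scoped ENNReal ContDiff Gradient

noncomputable section

namespace RandomDiffusion

/-- The plane, with the Euclidean norm. -/
abbrev Plane : Type := EuclideanSpace ℝ (Fin 2)

/-- The (open) unit square, the spatial domain. -/
def unitSquare : Set Plane := {x | ∀ i, x i ∈ Ioo (0 : ℝ) 1}

/-- Lebesgue measure on the unit square. -/
def squareMeasure : Measure Plane := (volume : Measure Plane).restrict unitSquare

/-- The real Hilbert space `L²(D)`, with `D` the unit square. -/
abbrev L2D : Type := Lp ℝ 2 squareMeasure

/-- The partial derivative `∂ᵢ φ`. -/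
def partialDeriv (i : Fin 2) (φ : Plane → ℝ) (x : Plane) : ℝ :=
  fderiv ℝ φ x (EuclideanSpace.single i 1)

/-- Test functions: the elements of `C_c^∞(D)`. -/
structure IsTestFunction (φ : Plane → ℝ) : Prop where
  contDiff : ContDiff ℝ ∞ φ
  hasCompactSupport : HasCompactSupport φ
  tsupport_subset : tsupport φ ⊆ unitSquare

/-- `G` is the weak gradient of `w`. -/
def HasWeakGradient (w : L2D) (G : Fin 2 → L2D) : Prop :=
  ∀ φ : Plane → ℝ, IsTestFunction φ → ∀ i : Fin 2,
    ∫ x, w x * partialDeriv i φ x ∂squareMeasure = - ∫ x, G i x * φ x ∂squareMeasure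

/-- `w` belongs to `H¹₀(D)`, the closure of `C_c^∞(D)` in the `H¹` norm, and has weak
gradient `G`. -/
structure IsH10WithGradient (w : L2D) (G : Fin 2 → L2D) : Prop where
  hasWeakGradient : HasWeakGradient w G
  approx : ∀ ε : ℝ≥0∞, 0 < ε → ∃ φ : Plane → ℝ, IsTestFunction φ ∧
    eLpNorm (fun x => w x - φ x) 2 squareMeasure < ε ∧
    ∀ i : Fin 2, eLpNorm (fun x => G i x - partialDeriv i φ x) 2 squareMeasure < ε

/-- `w ∈ H¹₀(D)` is the weak solution of `-div (κ ∇w) = u` in `D`, `w = 0` on `∂D`, where the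
coefficient `κ` is constant in space. -/
def IsWeakSolution (κ : ℝ) (u w : L2D) : Prop :=
  ∃ G : Fin 2 → L2D, IsH10WithGradient w G ∧
    ∀ φ : Plane → ℝ, IsTestFunction φ →
      ∫ x, κ * ∑ i : Fin 2, G i x * partialDeriv i φ x ∂squareMeasure
        = ∫ x, u x * φ x ∂squareMeasure

/-- `w` is an eigenfunction of the Laplacian with homogeneous Dirichlet condition:
`w ≠ 0`, `w ∈ H¹₀(D)` and `Δ w = μ w`, that is, `-Δ w = -μ w`, weakly. -/
def IsLaplacianEigenfunction (w : L2D) (μ : ℝ) : Prop :=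
  w ≠ 0 ∧ IsWeakSolution 1 (-(μ • w)) w

/-- The diffusion coefficient `ỹ = a exp ((y + 1) log (b / a) / 2)`. -/
def coeff (a b y : ℝ) : ℝ := a * Real.exp ((y + 1) * Real.log (b / a) / 2)

open Classical in
/-- The state `z(u, y)`: the weak solution of `-div (ỹ ∇z) = u` in `D`, `z = 0` on `∂D`
(with value `0` if there were none). -/
def state (a b : ℝ) (u : L2D) (y : ℝ) : L2D :=
  if h : ∃ w : L2D, IsWeakSolution (coeff a b y) u w then h.choose else 0

/-- `g(u, y) = ½ ‖z(u, y) - z_d‖² + (β / 2) ‖u‖²`. -/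
def cost (a b β : ℝ) (zd u : L2D) (y : ℝ) : ℝ :=
  1 / 2 * ‖state a b u y - zd‖ ^ 2 + β / 2 * ‖u‖ ^ 2

/-- `J(u) = 𝔼[g(u, Y)]`. -/
def objective {Ω : Type*} [MeasurableSpace Ω] (P : Measure Ω) (Y : Ω → ℝ)
    (a b β : ℝ) (zd u : L2D) : ℝ :=
  ∫ s, cost a b β zd u (Y s) ∂P

/-- The moment `𝔼[Ỹ^{-k}]`, where `Ỹ` is the coefficient at the random parameter `Y`. -/
def invMoment {Ω : Type*} [MeasurableSpace Ω] (P : Measure Ω) (Y : Ω → ℝ)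
    (a b : ℝ) (k : ℕ) : ℝ :=
  ∫ s, ((coeff a b (Y s))⁻¹) ^ k ∂P

end RandomDiffusion

end

/-!
Let `S = (-Δ)⁻¹ : L²(D) → L²(D)` be the solution operator of the Dirichlet problem. It is built by
the Lax–Milgram theorem on `H10`, the closure of the graph of the gradient on test functions;
coercivity of the Dirichlet form is the Poincaré inequality `IsTestFunction.poincare`. Symmetry of
the form makes `S` symmetric and positive, and `S` is injective because a function orthogonal to
all test functions vanishes (`eq_zero_of_poisson_eq_zero`).

The coefficient `κ` is constant in space, so the weak solutions for `u` are exactly `κ⁻¹ S u`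
(`isWeakSolution_iff`). Hence the cost is a quadratic polynomial in `κ⁻¹`, its gradient is
`κ⁻² S² u - κ⁻¹ S z_d + β u`, which inherits analyticity in the parameter from `κ⁻¹`, and the
objective is a quadratic functional of `u` that involves the random coefficient only through its
first two inverse moments `m₁`, `m₂` (`objective_eq`). An eigenfunction satisfies `S z_d = -λ z_d`,
with `λ < 0` by positivity of `S`, so the Euler–Lagrange equation
`m₂ S² u - m₁ S z_d + β u = 0` can be solved by a multiple `u = c z_d`, where `c` satisfies
`(m₂ λ² + β) c + m₁ λ = 0`. The objective exceeds its value there by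
`½ m₂ ‖S (v - u)‖² + ½ β ‖v - u‖²` (`quadratic_expansion`), which vanishes only at `v = u`, because
`S` is injective.
-/

namespace RandomDiffusion

/-! ### Test functions -/

lemma isOpen_unitSquare : IsOpen unitSquare := by
  have : unitSquare = ⋂ i : Fin 2, (fun x : Plane => x i) ⁻¹' Ioo (0 : ℝ) 1 := by
    ext x; simp [unitSquare]
  rw [this]
  exact isOpen_iInter_of_finite fun i => isOpen_Ioo.preimage (by fun_prop)

instance : IsFiniteMeasureOnCompacts squareMeasure := by
  unfold squareMeasure; infer_instance

lemma IsTestFunction.zero : IsTestFunction 0 :=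
  ⟨contDiff_const, HasCompactSupport.zero, by
    simp [tsupport, Function.support_zero]⟩

lemma IsTestFunction.add {φ ψ : Plane → ℝ} (hφ : IsTestFunction φ) (hψ : IsTestFunction ψ) :
    IsTestFunction (φ + ψ) :=
  ⟨hφ.contDiff.add hψ.contDiff, hφ.hasCompactSupport.add hψ.hasCompactSupport,
    (tsupport_add φ ψ).trans (union_subset hφ.tsupport_subset hψ.tsupport_subset)⟩

lemma IsTestFunction.const_smul {φ : Plane → ℝ} (c : ℝ) (hφ : IsTestFunction φ) :
    IsTestFunction (c • φ) :=
  ⟨contDiff_const.smul hφ.contDiff, hφ.hasCompactSupport.smul_left (f := fun _ => c),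
    (tsupport_smul_subset_right (fun _ => c) φ).trans hφ.tsupport_subset⟩

namespace IsTestFunction

variable {φ ψ : Plane → ℝ}

lemma differentiable (hφ : IsTestFunction φ) : Differentiable ℝ φ :=
  hφ.contDiff.differentiable (by simp)

lemma tsupport_partialDeriv_subset (i : Fin 2) :
    tsupport (partialDeriv i φ) ⊆ tsupport φ :=
  tsupport_fderiv_apply_subset ℝ (EuclideanSpace.single i 1)

lemma partialDeriv (hφ : IsTestFunction φ) (i : Fin 2) :
    IsTestFunction (partialDeriv i φ) where
  contDiff := (hφ.contDiff.fderiv_right (m := ∞) (by simp)).clm_apply contDiff_const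
  hasCompactSupport := hφ.hasCompactSupport.of_isClosed_subset (isClosed_tsupport _)
    (tsupport_partialDeriv_subset i)
  tsupport_subset := (tsupport_partialDeriv_subset i).trans hφ.tsupport_subset

lemma memLp (hφ : IsTestFunction φ) (p : ℝ≥0∞) : MemLp φ p squareMeasure :=
  hφ.contDiff.continuous.memLp_of_hasCompactSupport hφ.hasCompactSupport

/-- A test function vanishes off the square, so it does not matter whether a product with it is
integrated over the square or over the plane. -/
lemma setIntegral_eq (hφ : IsTestFunction φ) (f : Plane → ℝ) :
    ∫ x, f x * φ x ∂squareMeasure = ∫ x, f x * φ x := by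
  refine setIntegral_eq_integral_of_forall_compl_eq_zero fun x hx => ?_
  rw [image_eq_zero_of_notMem_tsupport fun h => hx (hφ.tsupport_subset h), mul_zero]

lemma integrable_mul (hφ : IsTestFunction φ) {f : Plane → ℝ} (hf : Continuous f) :
    Integrable (fun x => f x * φ x) :=
  (hf.mul hφ.contDiff.continuous).integrable_of_hasCompactSupport
    (hφ.hasCompactSupport.mul_left)

/-- Integration by parts on the square. There is no boundary term, because `φ` has compact support
in the square; `f` is only required to be smooth. -/
lemma integral_mul_partialDeriv (hφ : IsTestFunction φ) {f : Plane → ℝ} (hf : ContDiff ℝ ∞ f)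
    (i : Fin 2) :
    ∫ x, f x * RandomDiffusion.partialDeriv i φ x ∂squareMeasure
      = - ∫ x, RandomDiffusion.partialDeriv i f x * φ x ∂squareMeasure := by
  rw [(hφ.partialDeriv i).setIntegral_eq, hφ.setIntegral_eq]
  have hf' : ContDiff ℝ ∞ (RandomDiffusion.partialDeriv i f) :=
    (hf.fderiv_right (m := ∞) (by simp)).clm_apply contDiff_const
  exact integral_mul_fderiv_eq_neg_fderiv_mul_of_integrable
    (hφ.integrable_mul hf'.continuous) ((hφ.partialDeriv i).integrable_mul hf.continuous)
    (hφ.integrable_mul hf.continuous) (fun x _ => hf.differentiable (by simp) x)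
    (fun x _ => hφ.differentiable x)

/-- The Poincaré inequality for test functions. Integrating `∂₀(x₀ φ²)` gives
`∫ φ² = -2 ∫ x₀ φ ∂₀φ`, and `0 < x₀ < 1` on the square. -/
lemma poincare (hφ : IsTestFunction φ) :
    ∫ x, φ x * φ x ∂squareMeasure
      ≤ 4 * ∫ x, RandomDiffusion.partialDeriv 0 φ x * RandomDiffusion.partialDeriv 0 φ x
        ∂squareMeasure := by
  set d := RandomDiffusion.partialDeriv 0 φ with hd
  have hx : ContDiff ℝ ∞ (fun x : Plane => x 0) := by fun_prop
  have hder : ∀ x, RandomDiffusion.partialDeriv 0 (fun x : Plane => x 0 * φ x) x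
      = φ x + x 0 * d x := by
    intro x
    have h1 : HasFDerivAt (fun x : Plane => x 0) (EuclideanSpace.proj (𝕜 := ℝ) (0 : Fin 2)) x :=
      (EuclideanSpace.proj (𝕜 := ℝ) (0 : Fin 2)).hasFDerivAt
    have h2 := (h1.mul (hφ.differentiable x).hasFDerivAt).fderiv
    simp only [RandomDiffusion.partialDeriv, hd]
    erw [h2]
    simp
    ring
  have hparts := hφ.integral_mul_partialDeriv (hx.mul hφ.contDiff) 0
  simp only [hder, ← hd] at hparts
  have i1 : Integrable (fun x => φ x * φ x) squareMeasure :=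
    (hφ.integrable_mul hφ.contDiff.continuous).integrableOn
  have i2 : Integrable (fun x => x 0 * φ x * d x) squareMeasure :=
    ((hφ.partialDeriv 0).integrable_mul (hx.mul hφ.contDiff).continuous).integrableOn
  have i3 : Integrable (fun x => d x * d x) squareMeasure :=
    ((hφ.partialDeriv 0).integrable_mul (hφ.partialDeriv 0).contDiff.continuous).integrableOn
  have hsplit : ∫ x, (φ x + x 0 * d x) * φ x ∂squareMeasure
      = ∫ x, φ x * φ x ∂squareMeasure + ∫ x, x 0 * φ x * d x ∂squareMeasure := by
    rw [← integral_add i1 i2]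
    exact integral_congr_ae (.of_forall fun x => by ring)
  have hmono : ∫ x, -(x 0 * φ x * d x) ∂squareMeasure
      ≤ ∫ x, (1 / 4 * (φ x * φ x) + d x * d x) ∂squareMeasure := by
    refine integral_mono_ae i2.neg ((i1.const_mul _).add i3) ?_
    filter_upwards [ae_restrict_mem isOpen_unitSquare.measurableSet] with x hx
    obtain ⟨h0, h1⟩ := hx 0
    have : (x 0 * d x) ^ 2 ≤ d x ^ 2 := by
      rw [mul_pow]
      exact mul_le_of_le_one_left (sq_nonneg _) (pow_le_one₀ h0.le h1.le)
    nlinarith [sq_nonneg (φ x / 2 + x 0 * d x)]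
  rw [integral_neg, integral_add (i1.const_mul _) i3, integral_const_mul] at hmono
  linarith

end IsTestFunction

/-! ### The Sobolev space `H¹₀` of the square -/

/-- Triples `(w, G₀, G₁)` of `L²` functions, with the Hilbert norm: the ambient space of the graph
of the gradient. -/
abbrev Jet : Type := PiLp 2 (fun _ : Fin 3 => L2D)

/-- The `L²` class of a test function. -/
noncomputable def IsTestFunction.toL2 {φ : Plane → ℝ} (hφ : IsTestFunction φ) : L2D :=
  (hφ.memLp 2).toLp φ

lemma IsTestFunction.coeFn_toL2 {φ : Plane → ℝ} (hφ : IsTestFunction φ) :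
    hφ.toL2 =ᵐ[squareMeasure] φ :=
  (hφ.memLp 2).coeFn_toLp

lemma inner_L2D (u v : L2D) : inner ℝ u v = ∫ x, u x * v x ∂squareMeasure := by
  rw [L2.inner_def]
  exact integral_congr_ae (.of_forall fun x => by simp [mul_comm])

lemma IsTestFunction.inner_toL2 {φ : Plane → ℝ} (hφ : IsTestFunction φ) (u : L2D) :
    inner ℝ u hφ.toL2 = ∫ x, u x * φ x ∂squareMeasure := by
  rw [inner_L2D]
  refine integral_congr_ae ?_
  filter_upwards [hφ.coeFn_toL2] with x hx
  rw [hx]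

lemma IsTestFunction.inner_toL2_toL2 {φ ψ : Plane → ℝ} (hφ : IsTestFunction φ)
    (hψ : IsTestFunction ψ) :
    inner ℝ hφ.toL2 hψ.toL2 = ∫ x, φ x * ψ x ∂squareMeasure := by
  rw [hψ.inner_toL2]
  refine integral_congr_ae ?_
  filter_upwards [hφ.coeFn_toL2] with x hx
  rw [hx]

/-- The triple `(φ, ∂₀φ, ∂₁φ)` of a test function. -/
noncomputable def IsTestFunction.jet {φ : Plane → ℝ} (hφ : IsTestFunction φ) : Jet :=
  WithLp.toLp 2 (Fin.cons hφ.toL2 fun i => (hφ.partialDeriv i).toL2)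

@[simp] lemma IsTestFunction.jet_zero {φ : Plane → ℝ} (hφ : IsTestFunction φ) :
    hφ.jet 0 = hφ.toL2 := rfl

@[simp] lemma IsTestFunction.jet_succ {φ : Plane → ℝ} (hφ : IsTestFunction φ) (i : Fin 2) :
    hφ.jet i.succ = (hφ.partialDeriv i).toL2 := rfl

lemma partialDeriv_add {φ ψ : Plane → ℝ} (hφ : IsTestFunction φ) (hψ : IsTestFunction ψ)
    (i : Fin 2) : partialDeriv i (φ + ψ) = partialDeriv i φ + partialDeriv i ψ := by
  ext x
  simp [partialDeriv, fderiv_add (hφ.differentiable x) (hψ.differentiable x)]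

lemma partialDeriv_const_smul {φ : Plane → ℝ} (c : ℝ) (hφ : IsTestFunction φ)
    (i : Fin 2) : partialDeriv i (c • φ) = c • partialDeriv i φ := by
  ext x
  simp [partialDeriv, fderiv_const_smul (hφ.differentiable x)]

lemma IsTestFunction.toL2_add {φ ψ χ : Plane → ℝ} (hφ : IsTestFunction φ)
    (hψ : IsTestFunction ψ) (hχ : IsTestFunction χ) (h : χ = φ + ψ) :
    hχ.toL2 = hφ.toL2 + hψ.toL2 := by
  subst h
  exact MemLp.toLp_add (hφ.memLp 2) (hψ.memLp 2)

lemma IsTestFunction.toL2_const_smul {φ χ : Plane → ℝ} (c : ℝ) (hφ : IsTestFunction φ)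
    (hχ : IsTestFunction χ) (h : χ = c • φ) : hχ.toL2 = c • hφ.toL2 := by
  subst h
  exact MemLp.toLp_const_smul c (hφ.memLp 2)

lemma Jet.ext {x y : Jet} (h0 : x 0 = y 0) (h : ∀ i : Fin 2, x i.succ = y i.succ) : x = y := by
  ext1 j
  cases j using Fin.cases with
  | zero => exact h0
  | succ i => exact h i

lemma IsTestFunction.jet_add {φ ψ : Plane → ℝ} (hφ : IsTestFunction φ)
    (hψ : IsTestFunction ψ) : (hφ.add hψ).jet = hφ.jet + hψ.jet :=
  Jet.ext (toL2_add hφ hψ (hφ.add hψ) rfl) fun i =>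
    toL2_add (hφ.partialDeriv i) (hψ.partialDeriv i) ((hφ.add hψ).partialDeriv i)
      (partialDeriv_add hφ hψ i)

lemma IsTestFunction.jet_const_smul {φ : Plane → ℝ} (c : ℝ) (hφ : IsTestFunction φ) :
    (hφ.const_smul c).jet = c • hφ.jet :=
  Jet.ext (toL2_const_smul c hφ (hφ.const_smul c) rfl) fun i =>
    toL2_const_smul c (hφ.partialDeriv i) ((hφ.const_smul c).partialDeriv i)
      (partialDeriv_const_smul c hφ i)

/-- The graph of the gradient on test functions. -/
noncomputable def testJets : Submodule ℝ Jet where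
  carrier := {x | ∃ φ, ∃ hφ : IsTestFunction φ, hφ.jet = x}
  zero_mem' := ⟨_, IsTestFunction.zero.const_smul 0,
    (IsTestFunction.zero.jet_const_smul 0).trans (zero_smul ℝ _)⟩
  add_mem' := by
    rintro _ _ ⟨φ, hφ, rfl⟩ ⟨ψ, hψ, rfl⟩
    exact ⟨φ + ψ, hφ.add hψ, hφ.jet_add hψ⟩
  smul_mem' := by
    rintro c _ ⟨φ, hφ, rfl⟩
    exact ⟨c • φ, hφ.const_smul c, hφ.jet_const_smul c⟩

/-- The Sobolev space `H¹₀(D)`, encoded as the closure of the graph of the gradient on test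
functions: its elements are the triples `(w, ∂₀w, ∂₁w)` with `w ∈ H¹₀(D)`. -/
noncomputable def H10 : Submodule ℝ Jet := testJets.topologicalClosure

instance : CompleteSpace H10 :=
  testJets.isClosed_topologicalClosure.completeSpace_coe

lemma IsTestFunction.jet_mem_H10 {φ : Plane → ℝ} (hφ : IsTestFunction φ) : hφ.jet ∈ H10 :=
  testJets.le_topologicalClosure ⟨φ, hφ, rfl⟩

/-- A closed condition on triples holds on `H¹₀(D)` once it holds for test functions. -/
lemma H10_induction {p : Jet → Prop} (hp : IsClosed {x | p x})
    (h : ∀ φ, ∀ hφ : IsTestFunction φ, p hφ.jet) {x : Jet} (hx : x ∈ H10) : p x := by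
  have hsub : (testJets : Set Jet) ⊆ {x | p x} := by
    rintro _ ⟨φ, hφ, rfl⟩
    exact h φ hφ
  exact closure_minimal hsub hp hx

lemma H10.hasWeakGradient {x : Jet} (hx : x ∈ H10) :
    HasWeakGradient (x 0) (fun i => x i.succ) := by
  intro φ hφ i
  rw [← (hφ.partialDeriv i).inner_toL2, ← hφ.inner_toL2]
  refine H10_induction (p := fun x => inner ℝ (x 0) (hφ.partialDeriv i).toL2
    = -inner ℝ (x i.succ) hφ.toL2) (isClosed_eq (by fun_prop) (by fun_prop)) ?_ hx
  intro ψ hψ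
  rw [hψ.jet_zero, hψ.jet_succ, IsTestFunction.inner_toL2_toL2,
    IsTestFunction.inner_toL2_toL2, hφ.integral_mul_partialDeriv hψ.contDiff]

/-- The Poincaré inequality on `H¹₀(D)`. -/
lemma H10.poincare {x : Jet} (hx : x ∈ H10) : ‖x 0‖ ^ 2 ≤ 4 * ‖x 1‖ ^ 2 := by
  refine H10_induction (p := fun x => ‖x 0‖ ^ 2 ≤ 4 * ‖x 1‖ ^ 2)
    (isClosed_le (by fun_prop) (by fun_prop)) (fun φ hφ => ?_) hx
  have h1 : hφ.jet 1 = (hφ.partialDeriv 0).toL2 := rfl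
  rw [hφ.jet_zero, h1, ← real_inner_self_eq_norm_sq, ← real_inner_self_eq_norm_sq,
    IsTestFunction.inner_toL2_toL2, IsTestFunction.inner_toL2_toL2]
  exact hφ.poincare

/-- The distance between a component of a triple and a test function, as an integral norm of
functions rather than of classes. -/
lemma IsTestFunction.edist_toL2 {φ : Plane → ℝ} (hφ : IsTestFunction φ) (w : L2D) :
    edist w hφ.toL2 = eLpNorm (fun x => w x - φ x) 2 squareMeasure := by
  rw [Lp.edist_def]
  refine eLpNorm_congr_ae ?_
  filter_upwards [hφ.coeFn_toL2] with x hx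
  simp [hx]

/-- The triple of a function and a candidate gradient. -/
noncomputable def toJet (w : L2D) (G : Fin 2 → L2D) : Jet :=
  WithLp.toLp 2 (Fin.cons w G)

@[simp] lemma toJet_zero (w : L2D) (G : Fin 2 → L2D) : toJet w G 0 = w := rfl

@[simp] lemma toJet_succ (w : L2D) (G : Fin 2 → L2D) (i : Fin 2) :
    toJet w G i.succ = G i := rfl

lemma isH10WithGradient_iff {w : L2D} {G : Fin 2 → L2D} :
    IsH10WithGradient w G ↔ toJet w G ∈ H10 := by
  constructor
  · intro h
    have hcl : toJet w G ∈ closure (testJets : Set Jet) := by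
      rw [Metric.mem_closure_iff]
      intro ε hε
      obtain ⟨φ, hφ, h0, h1⟩ := h.approx (ENNReal.ofReal (ε / 2))
        (ENNReal.ofReal_pos.2 (by positivity))
      refine ⟨hφ.jet, ⟨φ, hφ, rfl⟩, ?_⟩
      have hdist : ∀ j, dist (toJet w G j) (hφ.jet j) < ε / 2 := by
        intro j
        rw [← edist_lt_ofReal]
        refine Fin.cases ?_ (fun i => ?_) j
        · rw [hφ.jet_zero, hφ.edist_toL2]
          exact h0
        · rw [hφ.jet_succ, IsTestFunction.edist_toL2]
          exact h1 i
      have hsq : dist (toJet w G) hφ.jet ^ 2 < ε ^ 2 := by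
        rw [dist_eq_norm, PiLp.norm_sq_eq_of_L2, Fin.sum_univ_three]
        have hj : ∀ j, ‖(toJet w G - hφ.jet) j‖ ^ 2 ≤ (ε / 2) ^ 2 := fun j =>
          pow_le_pow_left₀ (norm_nonneg _)
            (by rw [PiLp.sub_apply, ← dist_eq_norm]; exact (hdist j).le) 2
        nlinarith [hj 0, hj 1, hj 2]
      exact lt_of_pow_lt_pow_left₀ 2 hε.le hsq
    exact hcl
  · intro h
    refine ⟨H10.hasWeakGradient h, fun ε hε => ?_⟩
    have hcl : toJet w G ∈ closure (testJets : Set Jet) := h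
    obtain ⟨_, ⟨φ, hφ, rfl⟩, hd⟩ := EMetric.mem_closure_iff.1 hcl ε hε
    refine ⟨φ, hφ, ?_, fun i => ?_⟩
    · rw [← hφ.edist_toL2]
      exact (PiLp.edist_apply_le (toJet w G) hφ.jet 0).trans_lt hd
    · rw [← (hφ.partialDeriv i).edist_toL2]
      exact (PiLp.edist_apply_le (toJet w G) hφ.jet i.succ).trans_lt hd

/-! ### The solution operator of the Poisson problem -/

/-- The `j`-th component of an element `(w, ∂₀w, ∂₁w)` of `H¹₀(D)`. -/
noncomputable def H10.component (j : Fin 3) : H10 →L[ℝ] L2D :=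
  (PiLp.proj 2 (fun _ : Fin 3 => L2D) j).comp H10.subtypeL

@[simp] lemma H10.component_apply (j : Fin 3) (x : H10) : H10.component j x = (x : Jet) j := rfl

/-- The Dirichlet form `(x, y) ↦ ∫ ∇x · ∇y` on `H¹₀(D)`. -/
noncomputable def dirichletForm : H10 →L[ℝ] H10 →L[ℝ] ℝ :=
  ∑ i : Fin 2, (isBoundedBilinearMap_inner (𝕜 := ℝ) (E := L2D)).toContinuousLinearMap.bilinearComp
    (H10.component i.succ) (H10.component i.succ)

lemma dirichletForm_apply (x y : H10) :
    dirichletForm x y = ∑ i : Fin 2, inner ℝ ((x : Jet) i.succ) ((y : Jet) i.succ) := by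
  simp only [dirichletForm, _root_.sum_apply]
  rfl

lemma dirichletForm_comm (x y : H10) : dirichletForm x y = dirichletForm y x := by
  simp only [dirichletForm_apply, real_inner_comm]

lemma dirichletForm_self_nonneg (x : H10) : 0 ≤ dirichletForm x x := by
  rw [dirichletForm_apply]
  exact Finset.sum_nonneg fun i _ => real_inner_self_nonneg

lemma isCoercive_dirichletForm : IsCoercive dirichletForm := by
  -- `‖x‖² = ‖w‖² + ‖∇w‖²`, and the Poincaré inequality gives `‖w‖² ≤ 4 ‖∇w‖²`.
  refine ⟨1 / 5, by norm_num, fun x => ?_⟩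
  have hp := H10.poincare x.2
  have hn : ‖x‖ ^ 2 = ‖(x : Jet) 0‖ ^ 2 + ‖(x : Jet) 1‖ ^ 2 + ‖(x : Jet) 2‖ ^ 2 := by
    have hcoe : ‖x‖ = ‖(x : Jet)‖ := rfl
    rw [hcoe, PiLp.norm_sq_eq_of_L2, Fin.sum_univ_three]
  have hB : dirichletForm x x = ‖(x : Jet) 1‖ ^ 2 + ‖(x : Jet) 2‖ ^ 2 := by
    rw [dirichletForm_apply, Fin.sum_univ_two, real_inner_self_eq_norm_sq,
      real_inner_self_eq_norm_sq]
    rfl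
  nlinarith [sq_nonneg ‖(x : Jet) 2‖]

lemma eq_zero_of_dirichletForm_self_eq_zero {x : H10} (h : dirichletForm x x = 0) : x = 0 := by
  obtain ⟨C, hC, hcoer⟩ := isCoercive_dirichletForm
  have := hcoer x
  rw [h, mul_assoc] at this
  have h0 : ‖x‖ * ‖x‖ ≤ 0 := nonpos_of_mul_nonpos_right this hC
  exact norm_eq_zero.1 (mul_self_eq_zero.1 (le_antisymm h0 (mul_self_nonneg _)))

/-- The Lax–Milgram solution `(w, ∂₀w, ∂₁w)` of `-Δw = u`, as an element of `H¹₀(D)`. -/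
noncomputable def poissonJet : L2D →L[ℝ] H10 :=
  (isCoercive_dirichletForm.continuousLinearEquivOfBilin.symm : H10 →L[ℝ] H10).comp
    (ContinuousLinearMap.adjoint (H10.component 0))

lemma dirichletForm_poissonJet (u : L2D) (y : H10) :
    dirichletForm (poissonJet u) y = inner ℝ u ((y : Jet) 0) := by
  rw [← isCoercive_dirichletForm.continuousLinearEquivOfBilin_apply]
  simp [poissonJet, ContinuousLinearMap.adjoint_inner_left]

/-- The solution operator `(-Δ)⁻¹` on `L²(D)`. -/
noncomputable def poisson : L2D →L[ℝ] L2D := (H10.component 0).comp poissonJet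

lemma poisson_apply (u : L2D) : poisson u = (poissonJet u : Jet) 0 := rfl

lemma inner_poisson_right (u v : L2D) :
    inner ℝ u (poisson v) = dirichletForm (poissonJet u) (poissonJet v) :=
  (dirichletForm_poissonJet u (poissonJet v)).symm

lemma inner_poisson_left (u v : L2D) : inner ℝ (poisson u) v = inner ℝ u (poisson v) := by
  rw [real_inner_comm, inner_poisson_right, inner_poisson_right, dirichletForm_comm]

lemma inner_poisson_self_nonneg (u : L2D) : 0 ≤ inner ℝ u (poisson u) := by
  rw [inner_poisson_right]
  exact dirichletForm_self_nonneg _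

lemma eq_zero_of_forall_integral_mul_eq_zero {u : L2D}
    (h : ∀ φ, IsTestFunction φ → ∫ x, u x * φ x ∂squareMeasure = 0) : u = 0 := by
  have hu : LocallyIntegrable u squareMeasure :=
    (Lp.memLp u).locallyIntegrable (by norm_num)
  have hae := isOpen_unitSquare.ae_eq_zero_of_integral_contDiff_smul_eq_zero
    (μ := squareMeasure) (hu.locallyIntegrableOn unitSquare) fun g hg hc hs => by
      rw [← h g ⟨hg, hc, hs⟩]
      exact integral_congr_ae (.of_forall fun x => by simp [mul_comm])
  rw [Lp.eq_zero_iff_ae_eq_zero]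
  filter_upwards [hae, ae_restrict_mem isOpen_unitSquare.measurableSet] with x hx hxs
  exact hx hxs

lemma eq_zero_of_poisson_eq_zero {u : L2D} (h : poisson u = 0) : u = 0 := by
  have hj : poissonJet u = 0 := eq_zero_of_dirichletForm_self_eq_zero <| by
    rw [← inner_poisson_right, h, inner_zero_right]
  refine eq_zero_of_forall_integral_mul_eq_zero fun φ hφ => ?_
  have := dirichletForm_poissonJet u ⟨hφ.jet, hφ.jet_mem_H10⟩
  rw [hj, map_zero, _root_.zero_apply, hφ.jet_zero, hφ.inner_toL2] at this
  exact this.symm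

/-- Weak solutions may be tested with all of `H¹₀(D)`. -/
lemma isWeakSolution_iff_exists_H10 {κ : ℝ} {u w : L2D} :
    IsWeakSolution κ u w ↔ ∃ x : H10, (x : Jet) 0 = w ∧
      ∀ y : H10, κ * dirichletForm x y = inner ℝ u ((y : Jet) 0) := by
  have key : ∀ (x : H10) (φ : Plane → ℝ) (hφ : IsTestFunction φ),
      ∫ z, κ * ∑ i : Fin 2, ((x : Jet) i.succ) z * partialDeriv i φ z ∂squareMeasure
        = κ * dirichletForm x ⟨hφ.jet, hφ.jet_mem_H10⟩ := by
    intro x φ hφ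
    rw [integral_const_mul, integral_finsetSum, dirichletForm_apply]
    · simp only [hφ.jet_succ, IsTestFunction.inner_toL2]
    · exact fun i _ => (Lp.memLp _).integrable_mul ((hφ.partialDeriv i).memLp 2)
  constructor
  · rintro ⟨G, hG, hsol⟩
    let x : H10 := ⟨toJet w G, isH10WithGradient_iff.1 hG⟩
    refine ⟨x, rfl, fun y => ?_⟩
    have hc : IsClosed {y : Jet | κ * ∑ i : Fin 2, inner ℝ ((x : Jet) i.succ) (y i.succ)
        = inner ℝ u (y 0)} := isClosed_eq (by fun_prop) (by fun_prop)
    rw [dirichletForm_apply]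
    refine H10_induction (p := fun y : Jet => κ * ∑ i : Fin 2,
      inner ℝ ((x : Jet) i.succ) (y i.succ) = inner ℝ u (y 0)) hc (fun φ hφ => ?_) y.2
    rw [hφ.jet_zero, hφ.inner_toL2, ← hsol φ hφ]
    exact ((key x φ hφ).trans (by rw [dirichletForm_apply])).symm
  · rintro ⟨x, rfl, hx⟩
    refine ⟨fun i => (x : Jet) i.succ, isH10WithGradient_iff.2 ?_, fun φ hφ => ?_⟩
    · have : toJet ((x : Jet) 0) (fun i => (x : Jet) i.succ) = x := Jet.ext rfl fun _ => rfl
      rw [this]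
      exact x.2
    · rw [key x φ hφ, hx, hφ.jet_zero, hφ.inner_toL2]

/-- A constant coefficient only rescales the solution. -/
lemma isWeakSolution_iff {κ : ℝ} (hκ : κ ≠ 0) {u w : L2D} :
    IsWeakSolution κ u w ↔ w = κ⁻¹ • poisson u := by
  rw [isWeakSolution_iff_exists_H10]
  constructor
  · rintro ⟨x, rfl, hx⟩
    have h0 : κ • x - poissonJet u = 0 := by
      have hall : ∀ y, dirichletForm (κ • x - poissonJet u) y = 0 := fun y => by
        rw [map_sub, map_smul, _root_.sub_apply, _root_.smul_apply, smul_eq_mul, hx,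
          dirichletForm_poissonJet, sub_self]
      exact eq_zero_of_dirichletForm_self_eq_zero (hall _)
    have h1 : poissonJet u = κ • x := (sub_eq_zero.1 h0).symm
    rw [poisson_apply, h1]
    simp [smul_smul, hκ]
  · rintro rfl
    refine ⟨κ⁻¹ • poissonJet u, rfl, fun y => ?_⟩
    rw [map_smul, _root_.smul_apply, dirichletForm_poissonJet, smul_eq_mul,
      mul_inv_cancel_left₀ hκ]

/-! ### State and cost -/

lemma coeff_pos {a b : ℝ} (ha : 0 < a) (y : ℝ) : 0 < coeff a b y := by
  unfold coeff; positivity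

lemma state_eq {a b : ℝ} (ha : 0 < a) (u : L2D) (y : ℝ) :
    state a b u y = (coeff a b y)⁻¹ • poisson u := by
  have h : ∃ w : L2D, IsWeakSolution (coeff a b y) u w :=
    ⟨_, (isWeakSolution_iff (coeff_pos ha y).ne').2 rfl⟩
  rw [state, dif_pos h]
  exact (isWeakSolution_iff (coeff_pos ha y).ne').1 h.choose_spec

lemma analyticAt_inv_coeff {a b : ℝ} (ha : 0 < a) (y : ℝ) :
    AnalyticAt ℝ (fun y => (coeff a b y)⁻¹) y := by
  refine AnalyticAt.inv ?_ (coeff_pos ha y).ne'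
  unfold coeff
  fun_prop

lemma cost_eq {a b β : ℝ} (ha : 0 < a) (zd u : L2D) (y : ℝ) :
    cost a b β zd u y = 1 / 2 * ‖poisson u‖ ^ 2 * ((coeff a b y)⁻¹) ^ 2
      - inner ℝ (poisson u) zd * (coeff a b y)⁻¹
      + (1 / 2 * ‖zd‖ ^ 2 + β / 2 * ‖u‖ ^ 2) := by
  rw [cost, state_eq ha, norm_sub_sq_real, norm_smul, inner_smul_left, mul_pow, Real.norm_eq_abs,
    sq_abs]
  simp only [conj_trivial]
  ring

/-- The gradient is `κ⁻² S² u - κ⁻¹ S z_d + β u`, with `S` the solution operator and `κ` the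
coefficient. -/
lemma hasGradientAt_cost {a b β : ℝ} (ha : 0 < a) (zd u : L2D) (y : ℝ) :
    HasGradientAt (fun v => cost a b β zd v y)
      (((coeff a b y)⁻¹) ^ 2 • poisson (poisson u) - (coeff a b y)⁻¹ • poisson zd + β • u) u := by
  rw [hasGradientAt_iff_hasFDerivAt]
  set k := (coeff a b y)⁻¹ with hk
  have hcost : (fun v => cost a b β zd v y)
      = fun v => 1 / 2 * ‖k • poisson v - zd‖ ^ 2 + β / 2 * ‖v‖ ^ 2 := by
    funext v
    rw [cost, state_eq ha]
  rw [hcost]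
  have h1 : HasFDerivAt (fun v => k • poisson v - zd) (k • poisson) u :=
    (poisson.hasFDerivAt.const_smul k).sub_const zd
  have h2 := (h1.norm_sq.const_mul (1 / 2)).add ((hasFDerivAt_id u).norm_sq.const_mul (β / 2))
  refine h2.congr_fderiv ?_
  ext h
  simp [inner_poisson_left]
  ring

lemma gradient_cost_analyticAt {a b β : ℝ} (ha : 0 < a) (zd u : L2D) (y : ℝ) :
    AnalyticAt ℝ (fun y => ∇ (fun v => cost a b β zd v y) u) y := by
  simp only [(hasGradientAt_cost ha zd u _).gradient]
  have hk := analyticAt_inv_coeff (b := b) ha y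
  exact ((((hk.pow 2).smul analyticAt_const).sub (hk.smul analyticAt_const)).add analyticAt_const)

/-! ### Moments of the coefficient -/

section Moments

variable {Ω : Type*} [MeasurableSpace Ω] {P : Measure Ω} {Y : Ω → ℝ} {a b : ℝ}

lemma ae_mem_Icc_of_isUniform (hY : pdf.IsUniform Y (Icc (-1 : ℝ) 1) P volume) :
    AEMeasurable Y P ∧ ∀ᵐ s ∂P, Y s ∈ Icc (-1 : ℝ) 1 := by
  have hm : AEMeasurable Y P := hY.aemeasurable (by simp) (by simp)
  refine ⟨hm, ae_of_ae_map hm ?_⟩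
  rw [hY]
  exact ae_cond_mem measurableSet_Icc

lemma integrable_inv_coeff_pow [IsProbabilityMeasure P]
    (hY : pdf.IsUniform Y (Icc (-1 : ℝ) 1) P volume) (ha : 0 < a) (hab : a < b) (k : ℕ) :
    Integrable (fun s => ((coeff a b (Y s))⁻¹) ^ k) P := by
  obtain ⟨hm, hmem⟩ := ae_mem_Icc_of_isUniform hY
  have hcont : Continuous fun y => ((coeff a b y)⁻¹) ^ k :=
    (continuous_iff_continuousAt.2 fun y => (analyticAt_inv_coeff ha y).continuousAt).pow k
  refine Integrable.of_bound (hcont.measurable.comp_aemeasurable hm).aestronglyMeasurable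
    ((a⁻¹) ^ k) ?_
  filter_upwards [hmem] with s hs
  have hle : a ≤ coeff a b (Y s) := by
    have hlog : 0 ≤ Real.log (b / a) := Real.log_nonneg ((one_le_div ha).2 hab.le)
    have hexp : 0 ≤ (Y s + 1) * Real.log (b / a) / 2 :=
      div_nonneg (mul_nonneg (by linarith [hs.1]) hlog) (by norm_num)
    exact le_mul_of_one_le_right ha.le (Real.one_le_exp hexp)
  have hpos := inv_pos.2 (coeff_pos (b := b) ha (Y s))
  rw [Real.norm_of_nonneg (pow_nonneg hpos.le k)]
  exact pow_le_pow_left₀ hpos.le (inv_anti₀ ha hle) k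

lemma invMoment_pos [IsProbabilityMeasure P]
    (hY : pdf.IsUniform Y (Icc (-1 : ℝ) 1) P volume) (ha : 0 < a) (hab : a < b) (k : ℕ) :
    0 < invMoment P Y a b k := by
  have hpos : ∀ s, 0 < ((coeff a b (Y s))⁻¹) ^ k := fun s =>
    pow_pos (inv_pos.2 (coeff_pos ha _)) k
  refine (integral_pos_iff_support_of_nonneg (fun s => (hpos s).le)
    (integrable_inv_coeff_pow hY ha hab k)).2 ?_
  have : Function.support (fun s => ((coeff a b (Y s))⁻¹) ^ k) = univ :=
    eq_univ_of_forall fun s => (hpos s).ne'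
  rw [this]
  simp

lemma integrable_cost [IsProbabilityMeasure P]
    (hY : pdf.IsUniform Y (Icc (-1 : ℝ) 1) P volume) (ha : 0 < a) (hab : a < b) (β : ℝ)
    (zd u : L2D) : Integrable (fun s => cost a b β zd u (Y s)) P := by
  simp only [cost_eq ha]
  have h1 := integrable_inv_coeff_pow hY ha hab 1
  simp only [pow_one] at h1
  exact (((integrable_inv_coeff_pow hY ha hab 2).const_mul _).sub (h1.const_mul _)).add
    (integrable_const _)

lemma objective_eq [IsProbabilityMeasure P]
    (hY : pdf.IsUniform Y (Icc (-1 : ℝ) 1) P volume) (ha : 0 < a) (hab : a < b) (β : ℝ)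
    (zd u : L2D) :
    objective P Y a b β zd u = 1 / 2 * ‖poisson u‖ ^ 2 * invMoment P Y a b 2
      - inner ℝ (poisson u) zd * invMoment P Y a b 1
      + (1 / 2 * ‖zd‖ ^ 2 + β / 2 * ‖u‖ ^ 2) := by
  have h1 := integrable_inv_coeff_pow hY ha hab 1
  have h2 := integrable_inv_coeff_pow hY ha hab 2
  simp only [pow_one] at h1
  simp only [objective, invMoment, cost_eq ha, pow_one]
  have h3 := (h2.const_mul (1 / 2 * ‖poisson u‖ ^ 2)).sub
    (h1.const_mul (inner ℝ (poisson u) zd))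
  simp only [Pi.sub_def] at h3
  rw [integral_add h3 (integrable_const _),
    integral_sub (h2.const_mul _) (h1.const_mul _), integral_const_mul, integral_const_mul]
  simp

end Moments

/-! ### The minimizer -/

lemma eigenvalue_neg {zd : L2D} {mu : ℝ} (h : IsLaplacianEigenfunction zd mu) : mu < 0 := by
  obtain ⟨hne, hsol⟩ := h
  rw [isWeakSolution_iff one_ne_zero] at hsol
  have hz : zd = -(mu • poisson zd) := by simpa using hsol
  have hsq : ‖zd‖ ^ 2 = -(mu * inner ℝ zd (poisson zd)) := by
    rw [← real_inner_self_eq_norm_sq]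
    nth_rewrite 2 [hz]
    rw [inner_neg_right, inner_smul_right]
  have hpos : 0 < ‖zd‖ ^ 2 := by positivity
  by_contra! hmu
  linarith [mul_nonneg hmu (inner_poisson_self_nonneg zd)]

lemma poisson_eigenfunction {zd : L2D} {mu : ℝ} (h : IsLaplacianEigenfunction zd mu) :
    poisson zd = -(mu⁻¹ • zd) := by
  have hmu := (eigenvalue_neg h).ne
  have hsol := (isWeakSolution_iff one_ne_zero).1 h.2
  have hz : zd = -(mu • poisson zd) := by simpa using hsol
  nth_rewrite 2 [hz]
  rw [smul_neg, neg_neg, smul_smul, inv_mul_cancel₀ hmu, one_smul]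

/-- At a multiple `c • z_d` satisfying the Euler–Lagrange equation `(m₂ λ² + β) c + m₁ λ = 0`, the
linear term of the expansion of the functional vanishes, and only the quadratic part is left. -/
lemma quadratic_expansion {zd : L2D} {lam m₁ m₂ β c : ℝ} (hS : poisson zd = -(lam • zd))
    (hc : (m₂ * lam ^ 2 + β) * c + m₁ * lam = 0) (J : L2D → ℝ)
    (hJ : ∀ u, J u = 1 / 2 * ‖poisson u‖ ^ 2 * m₂ - inner ℝ (poisson u) zd * m₁
      + (1 / 2 * ‖zd‖ ^ 2 + β / 2 * ‖u‖ ^ 2)) (v : L2D) :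
    J v = J (c • zd) + (1 / 2 * m₂ * ‖poisson (v - c • zd)‖ ^ 2
      + β / 2 * ‖v - c • zd‖ ^ 2) := by
  obtain ⟨h, rfl⟩ : ∃ h, v = c • zd + h := ⟨v - c • zd, by simp⟩
  have hh : inner ℝ (poisson h) zd = -(lam * inner ℝ zd h) := by
    rw [inner_poisson_left, hS, inner_neg_right, inner_smul_right, real_inner_comm]
  have hh' : inner ℝ zd (poisson h) = -(lam * inner ℝ zd h) := by rw [real_inner_comm, hh]
  rw [hJ, hJ, add_sub_cancel_left, map_add, norm_add_sq_real, norm_add_sq_real, inner_add_left, hh,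
    map_smul, hS]
  simp only [smul_neg, inner_neg_left, inner_smul_left, conj_trivial, hh']
  linear_combination (inner ℝ zd h) * hc

end RandomDiffusion

open RandomDiffusion in
theorem mainTheorem9 {Ω : Type*} [MeasurableSpace Ω] (P : Measure Ω) [IsProbabilityMeasure P]
    (Y : Ω → ℝ) (hY : pdf.IsUniform Y (Icc (-1 : ℝ) 1) P volume)
    (a b β : ℝ) (ha : 0 < a) (hab : a < b) (hβ : 0 ≤ β)
    (zd : RandomDiffusion.L2D) (mu lam : ℝ)
    (hzd : RandomDiffusion.IsLaplacianEigenfunction zd mu) (hlam : lam = mu⁻¹)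
    (α β' : ℝ)
    (hα : α = RandomDiffusion.invMoment P Y a b 1 / RandomDiffusion.invMoment P Y a b 2)
    (hβ' : β' = β / RandomDiffusion.invMoment P Y a b 2) :
    -- the state is well defined
    (∀ (u : RandomDiffusion.L2D) (y : ℝ),
      (∃! z, RandomDiffusion.IsWeakSolution (RandomDiffusion.coeff a b y) u z) ∧
      RandomDiffusion.IsWeakSolution (RandomDiffusion.coeff a b y) u
        (RandomDiffusion.state a b u y)) ∧
    -- the eigenvalue is invertible and the expectations are finite
    mu < 0 ∧
    Integrable (fun s => (RandomDiffusion.coeff a b (Y s))⁻¹) P ∧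
    Integrable (fun s => ((RandomDiffusion.coeff a b (Y s))⁻¹) ^ 2) P ∧
    0 < RandomDiffusion.invMoment P Y a b 2 ∧
    (∀ u : RandomDiffusion.L2D,
      Integrable (fun s => RandomDiffusion.cost a b β zd u (Y s)) P) ∧
    -- the unique minimizer
    (∀ u : RandomDiffusion.L2D,
      (∀ v : RandomDiffusion.L2D, RandomDiffusion.objective P Y a b β zd u
          ≤ RandomDiffusion.objective P Y a b β zd v) ↔
        u = (-(α * lam * (lam ^ 2 + β')⁻¹)) • zd) ∧
    -- the gradient exists and is analytic in the parameter
    (∀ y : ℝ, Differentiable ℝ (fun u => RandomDiffusion.cost a b β zd u y)) ∧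
    (∀ u : RandomDiffusion.L2D,
      AnalyticOnNhd ℝ (fun y : ℝ => ∇ (fun v => RandomDiffusion.cost a b β zd v y) u)
        (Icc (-1 : ℝ) 1)) := by
  have hm2 := invMoment_pos hY ha hab 2
  have hS := poisson_eigenfunction hzd
  rw [← hlam] at hS
  have hmu := eigenvalue_neg hzd
  have hlam0 : lam ≠ 0 := hlam ▸ inv_ne_zero hmu.ne
  have hm1 := integrable_inv_coeff_pow hY ha hab 1
  simp only [pow_one] at hm1
  have hweak : ∀ u y z, IsWeakSolution (coeff a b y) u z ↔ z = (coeff a b y)⁻¹ • poisson u :=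
    fun u y z => isWeakSolution_iff (coeff_pos ha y).ne'
  refine ⟨fun u y => ⟨⟨_, (hweak u y _).2 rfl, fun z hz => (hweak u y z).1 hz⟩,
    (hweak u y _).2 (state_eq ha u y)⟩, hmu, hm1, integrable_inv_coeff_pow hY ha hab 2, hm2,
    integrable_cost hY ha hab β zd, fun u => ?_,
    fun y u => (hasGradientAt_cost ha zd u y).hasFDerivAt.differentiableAt,
    fun u y _ => gradient_cost_analyticAt ha zd u y⟩
  set c := -(α * lam * (lam ^ 2 + β')⁻¹) with hc
  have hβ'0 : 0 ≤ β' := hβ' ▸ div_nonneg hβ hm2.le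
  have hden : lam ^ 2 + β' ≠ 0 := by positivity
  have hEL : (invMoment P Y a b 2 * lam ^ 2 + β) * c + invMoment P Y a b 1 * lam = 0 := by
    have e1 : invMoment P Y a b 1 = α * invMoment P Y a b 2 := by rw [hα]; field_simp
    have e2 : β = β' * invMoment P Y a b 2 := by rw [hβ']; field_simp
    rw [e1, e2, hc]
    field_simp
    ring
  -- `hEL` is the Euler–Lagrange equation, divided by the second moment in the definition of `c`.
  have hexp := quadratic_expansion hS hEL _ (objective_eq hY ha hab β zd)
  constructor
  · intro hmin
    have hle := hmin (c • zd)
    rw [hexp u] at hle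
    have hsq : ‖poisson (u - c • zd)‖ ^ 2 = 0 := by
      refine le_antisymm (nonpos_of_mul_nonpos_right (a := 1 / 2 * invMoment P Y a b 2) ?_
        (by positivity)) (sq_nonneg _)
      have : 0 ≤ β / 2 * ‖u - c • zd‖ ^ 2 := by positivity
      linarith
    -- Also for `β = 0`, the minimizer is unique because the solution operator is injective.
    exact sub_eq_zero.1 (eq_zero_of_poisson_eq_zero
      (norm_eq_zero.1 (pow_eq_zero_iff two_ne_zero |>.1 hsq)))
  · rintro rfl v
    rw [hexp v]
    exact le_add_of_nonneg_right (by positivity)
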